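/- Let $\mathrm{LJ}$ be Gentzen's first-order intuitionistic sequent calculus, with primitive logical symbols $\neg,\land,\lor,\supset,\forall,\exists$, initial sequents $A\rightarrow A$ for all formulas $A$, and sequents $\Gamma\rightarrow\Lambda$ in which $\Gamma$ is a finite sequence of formulas and $\Lambda$ consists of at most one formula. Let $\mathrm{ML}$ (minimal logic) be $\mathrm{LJ}$ without the rule of weakening on the right, and let $\mathrm{ML}^+$ be $\mathrm{ML}$ together with the rule $$\frac{A,\Gamma\rightarrow\Lambda\qquad \neg A,\Gamma\rightarrow\Lambda}{\Gamma\rightarrow\Lambda}\qquad(A\text{ any formula}).$$ The degree of a formula is given by $\partial(A)=1$ for $A$ atomic, $\partial(A\land B)=\partial(A\lor B)=\partial(A\supset B)=\max(\partial(A),\partial(B))+1$ and $\partial(\neg A)=\partial(\forall x A)=\partial(\exists x A)=\partial(A)+1$. The degree of a proof is the least upper bound of the degrees of the cut formulas of its cut rules (so it is $0$ if the proof is cut-free). Let $S$ be one of the systems $\mathrm{ML}$, $\mathrm{ML}^+$, let $C$ be a formula of degree $n$, and let $\pi,\pi'$ be proofs in $S$, of degrees $<n$, of $\Gamma\rightarrow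 C$ and $\Pi\rightarrow\Lambda$ respectively. Let $\Pi-C$ be any sequence obtained from $\Pi$ by deleting an arbitrary number (possibly none, possibly all) of the occurrences of $C$. Then there is a proof in $S$ of degree $<n$ of $\Gamma,\Pi-C\rightarrow\Lambda$. -/

import Mathlib

namespace MinLogic

open FirstOrder FirstOrder.Language

/-- First-order formulas over the (constant, function and predicate) symbols of `L`, with the
primitive logical symbols `¬, ∧, ∨, ⊃, ∀, ∃`.  The free variables are the natural numbers (left
summand); `Fin k` (right summand) are the bound variables whose quantifiers lie further out.
A quantifier applied to a member of `Fml L (k + 1)` binds the variable `Fin.last k`. -/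
inductive Fml (L : Language) : ℕ → Type _
  | rel {k l : ℕ} (R : L.Relations l) (ts : Fin l → L.Term (ℕ ⊕ Fin k)) : Fml L k
  | neg {k : ℕ} (A : Fml L k) : Fml L k
  | and {k : ℕ} (A B : Fml L k) : Fml L k
  | or {k : ℕ} (A B : Fml L k) : Fml L k
  | imp {k : ℕ} (A B : Fml L k) : Fml L k
  | all {k : ℕ} (A : Fml L (k + 1)) : Fml L k
  | ex {k : ℕ} (A : Fml L (k + 1)) : Fml L k

/-- Formulas in which every bound variable is bound; they may contain free variables. -/
abbrev Formula (L : Language) := Fml L 0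

namespace Fml

/-- The degree of a formula. -/
def degree {L : Language} : {k : ℕ} → Fml L k → ℕ
  | _, rel _ _ => 1
  | _, neg A => A.degree + 1
  | _, and A B => max A.degree B.degree + 1
  | _, or A B => max A.degree B.degree + 1
  | _, imp A B => max A.degree B.degree + 1
  | _, all A => A.degree + 1
  | _, ex A => A.degree + 1

/-- The free variable `a` occurs in the formula. -/
def Occurs {L : Language} (a : ℕ) : {k : ℕ} → Fml L k → Prop
  | _, rel _ ts => ∃ i, a ∈ (ts i).varFinsetLeft
  | _, neg A => A.Occurs a
  | _, and A B => A.Occurs a ∨ B.Occurs a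
  | _, or A B => A.Occurs a ∨ B.Occurs a
  | _, imp A B => A.Occurs a ∨ B.Occurs a
  | _, all A => A.Occurs a
  | _, ex A => A.Occurs a

/-- `A.inst t` is `A(t)`: the term `t` replaces the outermost bound variable `0`, and the
variables of the inner quantifiers are renumbered.  No variable of `t` can be captured. -/
def inst {L : Language} (t : L.Term ℕ) : {k : ℕ} → Fml L (k + 1) → Fml L k
  | _, rel R ts => rel R fun i => (ts i).subst
      (Sum.elim (fun a => Term.var (Sum.inl a))
        (Fin.cases (t.relabel Sum.inl) fun j => Term.var (Sum.inr j)))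
  | _, neg A => neg (A.inst t)
  | _, and A B => and (A.inst t) (B.inst t)
  | _, or A B => or (A.inst t) (B.inst t)
  | _, imp A B => imp (A.inst t) (B.inst t)
  | _, all A => all (A.inst t)
  | _, ex A => ex (A.inst t)

end Fml

/-- The free variable `a` does not occur in the sequent `Γ → Λ`. -/
def Fresh {L : Language} (a : ℕ) (Γ : List (Formula L)) (Λ : Option (Formula L)) : Prop :=
  (∀ A ∈ Γ, ¬ A.Occurs a) ∧ ∀ A ∈ Λ, ¬ A.Occurs a

/-- The two systems: minimal logic, and minimal logic with tertium non datur. -/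
inductive System
  | ML
  | MLplus

/-- `Proof S Γ Λ` is the type of proofs in `S` of the sequent `Γ → Λ`, whose succedent `Λ` is
empty or a single formula: the rules of the intuitionistic sequent calculus LJ except weakening
on the right and, in `MLplus`, additionally the rule `tnd`. -/
inductive Proof {L : Language} (S : System) : List (Formula L) → Option (Formula L) → Type _
  | ax (A : Formula L) : Proof S [A] (some A)
  | weakL {Γ : List (Formula L)} {Λ : Option (Formula L)} (A : Formula L)
      (p : Proof S Γ Λ) : Proof S (A :: Γ) Λ
  | contrL {Γ : List (Formula L)} {Λ : Option (Formula L)} {A : Formula L}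
      (p : Proof S (A :: A :: Γ) Λ) : Proof S (A :: Γ) Λ
  | exchL {Γ Δ : List (Formula L)} {Λ : Option (Formula L)} {A B : Formula L}
      (p : Proof S (Γ ++ A :: B :: Δ) Λ) : Proof S (Γ ++ B :: A :: Δ) Λ
  | cut {Γ Δ : List (Formula L)} {Λ : Option (Formula L)} (A : Formula L)
      (p : Proof S Γ (some A)) (q : Proof S (A :: Δ) Λ) : Proof S (Γ ++ Δ) Λ
  | negL {Γ : List (Formula L)} {A : Formula L}
      (p : Proof S Γ (some A)) : Proof S (A.neg :: Γ) none
  | negR {Γ : List (Formula L)} {A : Formula L}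
      (p : Proof S (A :: Γ) none) : Proof S Γ (some A.neg)
  | andL₁ {Γ : List (Formula L)} {Λ : Option (Formula L)} {A : Formula L} (B : Formula L)
      (p : Proof S (A :: Γ) Λ) : Proof S (A.and B :: Γ) Λ
  | andL₂ {Γ : List (Formula L)} {Λ : Option (Formula L)} (A : Formula L) {B : Formula L}
      (p : Proof S (B :: Γ) Λ) : Proof S (A.and B :: Γ) Λ
  | andR {Γ : List (Formula L)} {A B : Formula L}
      (p : Proof S Γ (some A)) (q : Proof S Γ (some B)) : Proof S Γ (some (A.and B))
  | orL {Γ : List (Formula L)} {Λ : Option (Formula L)} {A B : Formula L}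
      (p : Proof S (A :: Γ) Λ) (q : Proof S (B :: Γ) Λ) : Proof S (A.or B :: Γ) Λ
  | orR₁ {Γ : List (Formula L)} {A : Formula L} (B : Formula L)
      (p : Proof S Γ (some A)) : Proof S Γ (some (A.or B))
  | orR₂ {Γ : List (Formula L)} (A : Formula L) {B : Formula L}
      (p : Proof S Γ (some B)) : Proof S Γ (some (A.or B))
  | impL {Γ Δ : List (Formula L)} {Λ : Option (Formula L)} {A B : Formula L}
      (p : Proof S Γ (some A)) (q : Proof S (B :: Δ) Λ) : Proof S (A.imp B :: (Γ ++ Δ)) Λ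
  | impR {Γ : List (Formula L)} {A B : Formula L}
      (p : Proof S (A :: Γ) (some B)) : Proof S Γ (some (A.imp B))
  | allL {Γ : List (Formula L)} {Λ : Option (Formula L)} (A : Fml L 1) (t : L.Term ℕ)
      (p : Proof S (A.inst t :: Γ) Λ) : Proof S (A.all :: Γ) Λ
  | allR {Γ : List (Formula L)} (A : Fml L 1) (a : ℕ) (h : Fresh a Γ (some A.all))
      (p : Proof S Γ (some (A.inst (Term.var a)))) : Proof S Γ (some A.all)
  | exL {Γ : List (Formula L)} {Λ : Option (Formula L)} (A : Fml L 1) (a : ℕ)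
      (h : Fresh a (A.ex :: Γ) Λ)
      (p : Proof S (A.inst (Term.var a) :: Γ) Λ) : Proof S (A.ex :: Γ) Λ
  | exR {Γ : List (Formula L)} (A : Fml L 1) (t : L.Term ℕ)
      (p : Proof S Γ (some (A.inst t))) : Proof S Γ (some A.ex)
  | tnd {Γ : List (Formula L)} {Λ : Option (Formula L)} (h : S = System.MLplus) (A : Formula L)
      (p : Proof S (A :: Γ) Λ) (q : Proof S (A.neg :: Γ) Λ) : Proof S Γ Λ

namespace Proof

/-- The set of the degrees of the cut rules of a proof (that is, of their cut formulas). -/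
def cutDegrees {L : Language} {S : System} :
    {Γ : List (Formula L)} → {Λ : Option (Formula L)} → Proof S Γ Λ → Finset ℕ
  | _, _, ax _ => ∅
  | _, _, weakL _ p => p.cutDegrees
  | _, _, contrL p => p.cutDegrees
  | _, _, exchL p => p.cutDegrees
  | _, _, cut A p q => {A.degree} ∪ (p.cutDegrees ∪ q.cutDegrees)
  | _, _, negL p => p.cutDegrees
  | _, _, negR p => p.cutDegrees
  | _, _, andL₁ _ p => p.cutDegrees
  | _, _, andL₂ _ p => p.cutDegrees
  | _, _, andR p q => p.cutDegrees ∪ q.cutDegrees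
  | _, _, orL p q => p.cutDegrees ∪ q.cutDegrees
  | _, _, orR₁ _ p => p.cutDegrees
  | _, _, orR₂ _ p => p.cutDegrees
  | _, _, impL p q => p.cutDegrees ∪ q.cutDegrees
  | _, _, impR p => p.cutDegrees
  | _, _, allL _ _ p => p.cutDegrees
  | _, _, allR _ _ _ p => p.cutDegrees
  | _, _, exL _ _ _ p => p.cutDegrees
  | _, _, exR _ _ p => p.cutDegrees
  | _, _, tnd _ _ p q => p.cutDegrees ∪ q.cutDegrees

/-- The degree of a proof: the least upper bound of the degrees of its cut rules, which is `0`
for a cut-free proof. -/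
def degree {L : Language} {S : System} {Γ : List (Formula L)} {Λ : Option (Formula L)}
    (p : Proof S Γ Λ) : ℕ :=
  p.cutDegrees.sup id

end Proof

/-- `Deletion C Δ Δ'`: the sequence `Δ'` arises from `Δ` by deleting an arbitrary number
(possibly none, possibly all) of the occurrences of `C`. -/
inductive Deletion {L : Language} (C : Formula L) : List (Formula L) → List (Formula L) → Prop
  | nil : Deletion C [] []
  | keep (A : Formula L) {Δ Δ' : List (Formula L)} (h : Deletion C Δ Δ') :
      Deletion C (A :: Δ) (A :: Δ')
  | drop {Δ Δ' : List (Formula L)} (h : Deletion C Δ Δ') : Deletion C (C :: Δ) Δ'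

end MinLogic

/-!
A cut on `C` with `C.degree ≤ n` is pushed up the derivation of `C` until `C` is introduced on the
right, and then up the other derivation until `C` is also introduced on the left; there it is
replaced by cuts on immediate subformulas, whose degree is `< n`. No step weakens on the right,
because a left rule whose conclusion has a nonempty succedent is valid for every succedent.

Contractions and eigenvariables are kept out of this argument by carrying it out in a calculus whose
contexts matter only as sets and in which `∀` on the right and `∃` on the left have one premise for
each term. Proofs embed into that calculus since they are closed under substitution, and conversely
the premise for a fresh variable is all that the eigenvariable rules need.
-/

namespace MinLogic

open FirstOrder FirstOrder.Language

section Substitution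

variable {L : Language}

theorem term_subst_var {α : Type*} (s : L.Term α) : s.subst Term.var = s := by
  induction s with
  | var a => rfl
  | func F ts ih => simp only [Term.subst, ih]

theorem term_relabel_eq_subst {α β : Type*} (s : L.Term α) (f : α → β) :
    s.relabel f = s.subst fun a => Term.var (f a) := by
  induction s with
  | var a => rfl
  | func F ts ih => simp only [Term.subst, Term.relabel, ih]

theorem term_subst_subst {α β γ : Type*} (s : L.Term α) (f : α → L.Term β) (g : β → L.Term γ) :
    (s.subst f).subst g = s.subst fun a => (f a).subst g := by
  induction s with
  | var a => rfl
  | func F ts ih => simp only [Term.subst, ih]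

/-- The substitution on terms with `k` bound variables that is induced by a substitution `σ` of
terms for the free variables; the bound variables are fixed. -/
def liftSubst (σ : ℕ → L.Term ℕ) (k : ℕ) : ℕ ⊕ Fin k → L.Term (ℕ ⊕ Fin k) :=
  Sum.elim (fun a => (σ a).relabel Sum.inl) fun j => Term.var (Sum.inr j)

/-- The substitution of `t` for the outermost bound variable, as performed by `Fml.inst` on the
terms of an atomic formula. -/
def instSubst (t : L.Term ℕ) (k : ℕ) : ℕ ⊕ Fin (k + 1) → L.Term (ℕ ⊕ Fin k) :=
  Sum.elim (fun a => Term.var (Sum.inl a))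
    (Fin.cases (t.relabel Sum.inl) fun j => Term.var (Sum.inr j))

theorem liftSubst_var (k : ℕ) : liftSubst (L := L) Term.var k = Term.var := by
  funext x
  cases x <;> rfl

theorem term_subst_liftSubst_congr {k : ℕ} {σ τ : ℕ → L.Term ℕ} (s : L.Term (ℕ ⊕ Fin k))
    (h : ∀ a ∈ s.varFinsetLeft, σ a = τ a) :
    s.subst (liftSubst σ k) = s.subst (liftSubst τ k) := by
  induction s with
  | var x =>
    cases x with
    | inl a => simp only [Term.subst, liftSubst, Sum.elim_inl, h a (Finset.mem_singleton_self a)]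
    | inr j => rfl
  | func F ts ih =>
    rw [Term.subst, Term.subst]
    congr 1
    funext i
    exact ih i fun a ha => h a (Finset.mem_biUnion.2 ⟨i, Finset.mem_univ i, ha⟩)

theorem term_subst_instSubst_subst_liftSubst (σ : ℕ → L.Term ℕ) (t : L.Term ℕ) {k : ℕ}
    (s : L.Term (ℕ ⊕ Fin (k + 1))) :
    (s.subst (instSubst t k)).subst (liftSubst σ k) =
      (s.subst (liftSubst σ (k + 1))).subst (instSubst (t.subst σ) k) := by
  rw [term_subst_subst, term_subst_subst]
  congr 1
  funext x
  rcases x with a | j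
  · simp only [instSubst, liftSubst, Sum.elim_inl, Term.subst, term_relabel_eq_subst,
      term_subst_subst]
  · cases j using Fin.cases with
    | zero =>
      simp only [instSubst, liftSubst, Sum.elim_inr, Sum.elim_inl, Term.subst, Fin.cases_zero,
        term_relabel_eq_subst, term_subst_subst]
    | succ j => simp only [instSubst, liftSubst, Sum.elim_inr, Term.subst, Fin.cases_succ]

namespace Fml

/-- Simultaneous substitution of terms for the free variables. Substituting for all of them at once
lets an eigenvariable be replaced by any term without being renamed first. -/
def subst (σ : ℕ → L.Term ℕ) : {k : ℕ} → Fml L k → Fml L k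
  | k, rel R ts => rel R fun i => (ts i).subst (liftSubst σ k)
  | _, neg A => neg (A.subst σ)
  | _, and A B => and (A.subst σ) (B.subst σ)
  | _, or A B => or (A.subst σ) (B.subst σ)
  | _, imp A B => imp (A.subst σ) (B.subst σ)
  | _, all A => all (A.subst σ)
  | _, ex A => ex (A.subst σ)

theorem subst_var {k : ℕ} (A : Fml L k) : A.subst Term.var = A := by
  induction A with
  | rel R ts => simp only [subst, liftSubst_var, term_subst_var]
  | _ => simp only [subst, *]

theorem subst_congr {σ τ : ℕ → L.Term ℕ} {k : ℕ} (A : Fml L k)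
    (h : ∀ a, A.Occurs a → σ a = τ a) : A.subst σ = A.subst τ := by
  induction A with
  | rel R ts =>
    rw [subst, subst]
    congr 1
    funext i
    exact term_subst_liftSubst_congr _ fun a ha => h a ⟨i, ha⟩
  | neg A ih | all A ih | ex A ih => simp only [subst, ih h]
  | and A B ihA ihB | or A B ihA ihB | imp A B ihA ihB =>
    simp only [subst, ihA fun a ha => h a (.inl ha), ihB fun a ha => h a (.inr ha)]

theorem subst_update_of_not_occurs {k : ℕ} {A : Fml L k} {a : ℕ} (h : ¬ A.Occurs a)
    (σ : ℕ → L.Term ℕ) (t : L.Term ℕ) : A.subst (Function.update σ a t) = A.subst σ :=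
  A.subst_congr fun b hb => Function.update_of_ne (fun hba : b = a => h (hba ▸ hb)) t σ

theorem inst_rel (t : L.Term ℕ) {k l : ℕ} (R : L.Relations l)
    (ts : Fin l → L.Term (ℕ ⊕ Fin (k + 1))) :
    (rel R ts).inst t = rel R fun i => (ts i).subst (instSubst t k) := by
  rw [inst]
  rfl

theorem subst_inst (σ : ℕ → L.Term ℕ) (t : L.Term ℕ) {k : ℕ} (A : Fml L (k + 1)) :
    (A.inst t).subst σ = (A.subst σ).inst (t.subst σ) := by
  fun_induction inst t A with
  | case1 _ _ R ts =>
    rw [subst, subst, inst_rel]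
    exact congrArg (rel R) (funext fun i => term_subst_instSubst_subst_liftSubst σ t (ts i))
  | _ => simp only [subst, inst, *]

theorem subst_update_inst_var {k : ℕ} {A : Fml L (k + 1)} {a : ℕ} (h : ¬ A.Occurs a)
    (σ : ℕ → L.Term ℕ) (t : L.Term ℕ) :
    (A.inst (Term.var a)).subst (Function.update σ a t) = (A.subst σ).inst t := by
  rw [subst_inst, subst_update_of_not_occurs h, Term.subst, Function.update_self]

theorem degree_inst (t : L.Term ℕ) {k : ℕ} (A : Fml L (k + 1)) :
    (A.inst t).degree = A.degree := by
  fun_induction inst t A with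
  | case1 => rfl
  | _ => simp only [degree, *]

theorem degree_subst (σ : ℕ → L.Term ℕ) {k : ℕ} (A : Fml L k) :
    (A.subst σ).degree = A.degree := by
  induction A with
  | rel R ts => rfl
  | _ => simp only [subst, degree, *]

theorem finite_setOf_occurs {k : ℕ} (A : Fml L k) : {a | A.Occurs a}.Finite := by
  induction A with
  | rel R ts =>
    simp only [Occurs, Set.ofPred_exists]
    exact Set.finite_iUnion fun i => (ts i).varFinsetLeft.finite_toSet
  | neg _ ih | all _ ih | ex _ ih => exact ih
  | and _ _ ihA ihB | or _ _ ihA ihB | imp _ _ ihA ihB => exact ihA.union ihB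

end Fml

theorem exists_fresh (Γ : List (Formula L)) (Λ : Option (Formula L)) : ∃ a, Fresh a Γ Λ := by
  obtain ⟨a, ha⟩ := ((Γ ++ Λ.toList).finite_toSet.biUnion
    fun A _ => A.finite_setOf_occurs).exists_notMem
  simp only [Set.mem_iUnion, not_exists] at ha
  exact ⟨a, fun A hA => ha A (List.mem_append_left _ hA),
    fun A hA => ha A (List.mem_append_right _ (Option.mem_toList.2 hA))⟩

namespace Fresh

variable {a : ℕ} {Γ : List (Formula L)} {Λ : Option (Formula L)}

theorem map_subst_update_left (h : Fresh a Γ Λ) (σ : ℕ → L.Term ℕ) (t : L.Term ℕ) :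
    Γ.map (Fml.subst (Function.update σ a t)) = Γ.map (Fml.subst σ) :=
  List.map_congr_left fun A hA => Fml.subst_update_of_not_occurs (h.1 A hA) σ t

theorem map_subst_update_right (h : Fresh a Γ Λ) (σ : ℕ → L.Term ℕ) (t : L.Term ℕ) :
    Λ.map (Fml.subst (Function.update σ a t)) = Λ.map (Fml.subst σ) :=
  Option.map_congr fun A hA => Fml.subst_update_of_not_occurs (h.2 A hA) σ t

end Fresh

end Substitution

section Rules

variable {L : Language}

/-- `LeftRule Λ C M P`: a logical rule that introduces `C` on the left derives `C, Γ → Λ` from the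
minor premises `Γ → A` with `A ∈ M` and the major premises `A, Γ → Λ` with `A ∈ P`. Instead of an
eigenvariable, the rule for `∃` has a premise for every term. -/
inductive LeftRule :
    Option (Formula L) → Formula L → Set (Formula L) → Set (Formula L) → Prop
  | neg (A : Formula L) : LeftRule none A.neg {A} ∅
  | and₁ (Λ : Option (Formula L)) (A B : Formula L) : LeftRule Λ (A.and B) ∅ {A}
  | and₂ (Λ : Option (Formula L)) (A B : Formula L) : LeftRule Λ (A.and B) ∅ {B}
  | or (Λ : Option (Formula L)) (A B : Formula L) : LeftRule Λ (A.or B) ∅ {A, B}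
  | imp (Λ : Option (Formula L)) (A B : Formula L) : LeftRule Λ (A.imp B) {A} {B}
  | all (Λ : Option (Formula L)) (A : Fml L 1) (t : L.Term ℕ) : LeftRule Λ A.all ∅ {A.inst t}
  | ex (Λ : Option (Formula L)) (A : Fml L 1) : LeftRule Λ A.ex ∅ (Set.range fun t => A.inst t)

/-- `RightRule C P`: a logical rule that introduces `C` on the right derives `Γ → C` from the
premises `Δ, Γ → Λ` with `(Δ, Λ) ∈ P`. Instead of an eigenvariable, the rule for `∀` has a premise
for every term. -/
inductive RightRule : Formula L → Set (List (Formula L) × Option (Formula L)) → Prop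
  | neg (A : Formula L) : RightRule A.neg {([A], none)}
  | and (A B : Formula L) : RightRule (A.and B) {([], some A), ([], some B)}
  | or₁ (A B : Formula L) : RightRule (A.or B) {([], some A)}
  | or₂ (A B : Formula L) : RightRule (A.or B) {([], some B)}
  | imp (A B : Formula L) : RightRule (A.imp B) {([A], some B)}
  | all (A : Fml L 1) : RightRule A.all (Set.range fun t => ([], some (A.inst t)))
  | ex (A : Fml L 1) (t : L.Term ℕ) : RightRule A.ex {([], some (A.inst t))}

theorem LeftRule.of_some {C D : Formula L} {M P : Set (Formula L)}
    (h : LeftRule (some D) C M P) (Λ : Option (Formula L)) : LeftRule Λ C M P := by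
  cases h <;> constructor

end Rules

section Lists

variable {α : Type*} {Γ Δ : List α}

theorem append_subset_append (l : List α) (h : Δ ⊆ Γ) : l ++ Δ ⊆ l ++ Γ :=
  List.append_subset.2 ⟨List.subset_append_left l Γ, List.subset_append_of_subset_right l h⟩

theorem append_subset_cons_append {a : α} (l : List α) (h : Δ ⊆ a :: Γ) :
    l ++ Δ ⊆ a :: (l ++ Γ) :=
  List.Subset.trans (append_subset_append l h) List.perm_middle.subset

end Lists

/-- `Derives S n Γ Λ`: derivability of `Γ → Λ`, with cuts of degree `< n` only, in a variant of `S`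
for which the elimination of cuts needs neither contractions nor renamings: principal formulas stay
in the context, all premises share it, and the logical rules are `LeftRule` and `RightRule`. -/
inductive Derives {L : Language} (S : System) (n : ℕ) :
    List (Formula L) → Option (Formula L) → Prop
  | ax {Γ : List (Formula L)} {A : Formula L} (hA : A ∈ Γ) : Derives S n Γ (some A)
  | cut {Γ : List (Formula L)} {Λ : Option (Formula L)} (A : Formula L) (hA : A.degree < n)
      (left : Derives S n Γ (some A)) (right : Derives S n (A :: Γ) Λ) : Derives S n Γ Λ
  | left {Γ : List (Formula L)} {Λ : Option (Formula L)} {C : Formula L} {M P : Set (Formula L)}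
      (rule : LeftRule Λ C M P) (hC : C ∈ Γ) (minor : ∀ A ∈ M, Derives S n Γ (some A))
      (major : ∀ A ∈ P, Derives S n (A :: Γ) Λ) : Derives S n Γ Λ
  | right {Γ : List (Formula L)} {C : Formula L}
      {P : Set (List (Formula L) × Option (Formula L))} (rule : RightRule C P)
      (premises : ∀ s ∈ P, Derives S n (s.1 ++ Γ) s.2) : Derives S n Γ (some C)
  | tnd {Γ : List (Formula L)} {Λ : Option (Formula L)} (hS : S = System.MLplus) (A : Formula L)
      (pos : Derives S n (A :: Γ) Λ) (neg : Derives S n (A.neg :: Γ) Λ) : Derives S n Γ Λ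

namespace Derives

variable {L : Language} {S : System} {n : ℕ} {Γ Δ : List (Formula L)} {Λ : Option (Formula L)}
  {C : Formula L}

theorem weaken (h : Derives S n Γ Λ) (hΓ : Γ ⊆ Δ) : Derives S n Δ Λ := by
  induction h generalizing Δ with
  | ax hA => exact ax (hΓ hA)
  | cut A hA _ _ ihp ihq => exact cut A hA (ihp hΓ) (ihq (List.cons_subset_cons A hΓ))
  | left rule hC _ _ ih_minor ih_major =>
    exact left rule (hΓ hC) (fun A hA => ih_minor A hA hΓ)
      fun A hA => ih_major A hA (List.cons_subset_cons A hΓ)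
  | right rule _ ih => exact right rule fun s hs => ih s hs (append_subset_append s.1 hΓ)
  | tnd hS A _ _ ihp ihq =>
    exact tnd hS A (ihp (List.cons_subset_cons _ hΓ)) (ihq (List.cons_subset_cons _ hΓ))

theorem left_cons {M P : Set (Formula L)} (rule : LeftRule Λ C M P)
    (minor : ∀ A ∈ M, Derives S n Γ (some A)) (major : ∀ A ∈ P, Derives S n (A :: Γ) Λ) :
    Derives S n (C :: Γ) Λ :=
  left rule List.mem_cons_self (fun A hA => (minor A hA).weaken (List.subset_cons_self C Γ))
    fun A hA => (major A hA).weaken (List.cons_subset_cons A (List.subset_cons_self C Γ))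

theorem cut_append {A : Formula L} (hA : A.degree < n) (left : Derives S n Γ (some A))
    (right : Derives S n (A :: Δ) Λ) : Derives S n (Γ ++ Δ) Λ :=
  cut A hA (left.weaken (List.subset_append_left Γ Δ))
    (right.weaken (List.cons_subset_cons A (List.subset_append_right Γ Δ)))

theorem imp_cons_append {A B : Formula L} (minor : Derives S n Γ (some A))
    (major : Derives S n (B :: Δ) Λ) : Derives S n (A.imp B :: (Γ ++ Δ)) Λ := by
  refine left_cons (.imp Λ A B) ?_ ?_
  · rintro _ rfl
    exact minor.weaken (List.subset_append_left Γ Δ)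
  · rintro _ rfl
    exact major.weaken (List.cons_subset_cons _ (List.subset_append_right Γ Δ))

theorem of_leftRule_of_rightRule {M P : Set (Formula L)}
    {Q : Set (List (Formula L) × Option (Formula L))} (hn : C.degree ≤ n)
    (lrule : LeftRule Λ C M P) (minor : ∀ A ∈ M, Derives S n Γ (some A))
    (major : ∀ A ∈ P, Derives S n (A :: Γ) Λ)
    (rrule : RightRule C Q) (premises : ∀ s ∈ Q, Derives S n (s.1 ++ Γ) s.2) :
    Derives S n Γ Λ := by
  cases lrule with
  | neg A =>
    cases rrule
    exact cut A hn (minor A rfl) (premises _ rfl)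
  | and₁ _ A B =>
    cases rrule
    exact cut A ((le_max_left _ _).trans_lt hn) (premises _ (.inl rfl)) (major A rfl)
  | and₂ _ A B =>
    cases rrule
    exact cut B ((le_max_right _ _).trans_lt hn) (premises _ (.inr rfl)) (major B rfl)
  | or _ A B =>
    cases rrule with
    | or₁ => exact cut A ((le_max_left _ _).trans_lt hn) (premises _ rfl) (major A (.inl rfl))
    | or₂ => exact cut B ((le_max_right _ _).trans_lt hn) (premises _ rfl) (major B (.inr rfl))
  | imp _ A B =>
    cases rrule
    have hB : Derives S n Γ (some B) :=
      cut A ((le_max_left _ _).trans_lt hn) (minor A rfl) (premises _ rfl)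
    exact cut B ((le_max_right _ _).trans_lt hn) hB (major B rfl)
  | all _ A t =>
    cases rrule
    exact cut (A.inst t) ((A.degree_inst t).trans_lt hn) (premises _ ⟨t, rfl⟩) (major _ rfl)
  | ex _ A =>
    cases rrule with
    | ex _ t =>
      exact cut (A.inst t) ((A.degree_inst t).trans_lt hn) (premises _ rfl) (major _ ⟨t, rfl⟩)

theorem cut_of_rightRule {Q : Set (List (Formula L) × Option (Formula L))} (hn : C.degree ≤ n)
    (rrule : RightRule C Q) (premises : ∀ s ∈ Q, Derives S n (s.1 ++ Γ) s.2)
    (h : Derives S n Δ Λ) (hΔ : Δ ⊆ C :: Γ) : Derives S n Γ Λ := by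
  have weaken_premises {Γ : List (Formula L)} (l : List (Formula L))
      (premises : ∀ s ∈ Q, Derives S n (s.1 ++ Γ) s.2) :
      ∀ s ∈ Q, Derives S n (s.1 ++ (l ++ Γ)) s.2 := fun s hs =>
    (premises s hs).weaken (append_subset_append s.1 (List.subset_append_right l Γ))
  induction h generalizing Γ with
  | ax hA =>
    rcases List.mem_cons.1 (hΔ hA) with rfl | hA
    · exact right rrule premises
    · exact ax hA
  | cut A hA _ _ ihp ihq =>
    exact cut A hA (ihp premises hΔ)
      (ihq (weaken_premises [A] premises) (append_subset_cons_append [A] hΔ))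
  | @left Δ Λ D M P lrule hD _ _ ih_minor ih_major =>
    have minor : ∀ A ∈ M, Derives S n Γ (some A) := fun A hA => ih_minor A hA premises hΔ
    have major : ∀ A ∈ P, Derives S n (A :: Γ) Λ := fun A hA =>
      ih_major A hA (weaken_premises [A] premises) (append_subset_cons_append [A] hΔ)
    rcases List.mem_cons.1 (hΔ hD) with rfl | hD
    · exact of_leftRule_of_rightRule hn lrule minor major rrule premises
    · exact left lrule hD minor major
  | right rule _ ih =>
    exact right rule fun s hs =>
      ih s hs (weaken_premises s.1 premises) (append_subset_cons_append s.1 hΔ)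
  | tnd hS A _ _ ihp ihq =>
    exact tnd hS A (ihp (weaken_premises [A] premises) (append_subset_cons_append [A] hΔ))
      (ihq (weaken_premises [A.neg] premises) (append_subset_cons_append [A.neg] hΔ))

theorem cut_of_degree_le (hn : C.degree ≤ n) (hC : Derives S n Γ (some C))
    (h : Derives S n (C :: Γ) Λ) : Derives S n Γ Λ := by
  have weaken_cons {Γ : List (Formula L)} (A : Formula L) (h : Derives S n (C :: Γ) Λ) :
      Derives S n (C :: A :: Γ) Λ :=
    h.weaken (List.cons_subset_cons C (List.subset_cons_self A Γ))
  generalize hD : some C = D at hC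
  induction hC with
  | ax hA =>
    cases hD
    exact h.weaken (List.cons_subset.2 ⟨hA, List.Subset.refl _⟩)
  | cut A hA p _ _ ihq => exact cut A hA p (ihq (weaken_cons A h) hD)
  | left rule hB minor _ _ ih =>
    subst hD
    exact left (rule.of_some Λ) hB minor fun A hA => ih A hA (weaken_cons A h) rfl
  | right rule premises _ =>
    cases hD
    exact cut_of_rightRule hn rule premises h (List.Subset.refl _)
  | tnd hS A _ _ ihp ihq =>
    exact tnd hS A (ihp (weaken_cons A h) hD) (ihq (weaken_cons A.neg h) hD)

theorem right_all_of_fresh {A : Fml L 1} {a : ℕ} (h : Fresh a Γ (some A.all))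
    (σ : ℕ → L.Term ℕ) (premise : ∀ τ : ℕ → L.Term ℕ,
      Derives S n (Γ.map (Fml.subst τ)) (some ((A.inst (Term.var a)).subst τ))) :
    Derives S n (Γ.map (Fml.subst σ)) (some (A.all.subst σ)) := by
  have hA : ¬ A.Occurs a := h.2 A.all rfl
  refine .right (.all _) ?_
  rintro _ ⟨t, rfl⟩
  simpa only [h.map_subst_update_left, Fml.subst_update_inst_var hA, List.nil_append] using
    premise (Function.update σ a t)

theorem left_ex_of_fresh {A : Fml L 1} {a : ℕ} (h : Fresh a (A.ex :: Γ) Λ)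
    (σ : ℕ → L.Term ℕ) (premise : ∀ τ : ℕ → L.Term ℕ,
      Derives S n ((A.inst (Term.var a)).subst τ :: Γ.map (Fml.subst τ)) (Λ.map (Fml.subst τ))) :
    Derives S n (A.ex.subst σ :: Γ.map (Fml.subst σ)) (Λ.map (Fml.subst σ)) := by
  have hA : ¬ A.Occurs a := h.1 A.ex List.mem_cons_self
  have hΓ : Fresh a Γ Λ := ⟨fun B hB => h.1 B (List.mem_cons_of_mem _ hB), h.2⟩
  refine .left_cons (.ex _ _) (by simp) ?_
  rintro _ ⟨t, rfl⟩
  simpa only [hΓ.map_subst_update_left, hΓ.map_subst_update_right,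
    Fml.subst_update_inst_var hA] using premise (Function.update σ a t)

end Derives

namespace Proof

variable {L : Language} {S : System} {n : ℕ} {Γ Δ : List (Formula L)} {Λ : Option (Formula L)}
  {A B : Formula L}

theorem degree_cut_lt {p : Proof S Γ (some A)} {q : Proof S (A :: Δ) Λ} :
    (cut A p q).degree < n ↔ A.degree < n ∧ p.degree < n ∧ q.degree < n := by
  simp only [degree, cutDegrees, Finset.sup_union, Finset.sup_singleton, id, sup_lt_iff]

theorem degree_andR_lt {p : Proof S Γ (some A)} {q : Proof S Γ (some B)} :
    (andR p q).degree < n ↔ p.degree < n ∧ q.degree < n := by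
  simp only [degree, cutDegrees, Finset.sup_union, sup_lt_iff]

theorem degree_orL_lt {p : Proof S (A :: Γ) Λ} {q : Proof S (B :: Γ) Λ} :
    (orL p q).degree < n ↔ p.degree < n ∧ q.degree < n := by
  simp only [degree, cutDegrees, Finset.sup_union, sup_lt_iff]

theorem degree_impL_lt {p : Proof S Γ (some A)} {q : Proof S (B :: Δ) Λ} :
    (impL p q).degree < n ↔ p.degree < n ∧ q.degree < n := by
  simp only [degree, cutDegrees, Finset.sup_union, sup_lt_iff]

theorem degree_tnd_lt {hS : S = System.MLplus} {p : Proof S (A :: Γ) Λ}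
    {q : Proof S (A.neg :: Γ) Λ} :
    (tnd hS A p q).degree < n ↔ p.degree < n ∧ q.degree < n := by
  simp only [degree, cutDegrees, Finset.sup_union, sup_lt_iff]

theorem derives_map_subst (p : Proof S Γ Λ) (hp : p.degree < n) (σ : ℕ → L.Term ℕ) :
    Derives S n (Γ.map (Fml.subst σ)) (Λ.map (Fml.subst σ)) := by
  induction p generalizing σ with
  | ax A => exact .ax List.mem_cons_self
  | weakL A _ ih => exact (ih hp σ).weaken (List.subset_cons_self _ _)
  | contrL _ ih => exact (ih hp σ).weaken (by simp)
  | exchL _ ih =>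
    exact (ih hp σ).weaken (List.map_subset _ ((List.Perm.swap _ _ _).append_left _).subset)
  | cut A _ _ ihp ihq =>
    obtain ⟨hA, hp, hq⟩ := degree_cut_lt.1 hp
    simpa using Derives.cut_append ((A.degree_subst σ).trans_lt hA) (ihp hp σ) (ihq hq σ)
  | negL _ ih => exact .left_cons (.neg _) (by simpa using ih hp σ) (by simp)
  | negR _ ih => exact .right (.neg _) (by simpa using ih hp σ)
  | andL₁ _ _ ih => exact .left_cons (.and₁ ..) (by simp) (by simpa using ih hp σ)
  | andL₂ _ _ ih => exact .left_cons (.and₂ ..) (by simp) (by simpa using ih hp σ)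
  | andR _ _ ihp ihq =>
    obtain ⟨hp, hq⟩ := degree_andR_lt.1 hp
    exact .right (.and ..) (by simpa using ⟨ihp hp σ, ihq hq σ⟩)
  | orL _ _ ihp ihq =>
    obtain ⟨hp, hq⟩ := degree_orL_lt.1 hp
    exact .left_cons (.or ..) (by simp) (by simpa using ⟨ihp hp σ, ihq hq σ⟩)
  | orR₁ _ _ ih => exact .right (.or₁ ..) (by simpa using ih hp σ)
  | orR₂ _ _ ih => exact .right (.or₂ ..) (by simpa using ih hp σ)
  | impL _ _ ihp ihq =>
    obtain ⟨hp, hq⟩ := degree_impL_lt.1 hp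
    simpa [Fml.subst] using Derives.imp_cons_append (ihp hp σ) (ihq hq σ)
  | impR _ ih => exact .right (.imp ..) (by simpa using ih hp σ)
  | allL A t _ ih =>
    exact .left_cons (.all _ _ (t.subst σ)) (by simp) (by simpa [Fml.subst_inst] using ih hp σ)
  | allR A a h _ ih => exact Derives.right_all_of_fresh h σ (ih hp)
  | exL A a h _ ih => exact Derives.left_ex_of_fresh h σ (ih hp)
  | exR A t _ ih => exact .right (.ex _ (t.subst σ)) (by simpa [Fml.subst_inst] using ih hp σ)
  | tnd hS A _ _ ihp ihq =>
    obtain ⟨hp, hq⟩ := degree_tnd_lt.1 hp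
    exact .tnd hS (A.subst σ) (ihp hp σ) (ihq hq σ)

theorem derives (p : Proof S Γ Λ) (hp : p.degree < n) : Derives S n Γ Λ := by
  have subst_var : (Fml.subst Term.var : Formula L → Formula L) = id := funext Fml.subst_var
  simpa only [subst_var, List.map_id, Option.map_id, id] using p.derives_map_subst hp Term.var

end Proof

/-- There is a proof of `Γ → Λ` in `S` of degree `< n`. -/
def Provable {L : Language} (S : System) (n : ℕ) (Γ : List (Formula L))
    (Λ : Option (Formula L)) : Prop :=
  ∃ p : Proof S Γ Λ, p.degree < n

namespace Provable

variable {L : Language} {S : System} {n : ℕ} {Γ Δ : List (Formula L)} {Λ : Option (Formula L)}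
  {C : Formula L}

theorem perm (h : Γ.Perm Δ) (hΓ : Provable S n Γ Λ) : Provable S n Δ Λ := by
  suffices ∀ Ξ, Provable S n (Ξ ++ Γ) Λ → Provable S n (Ξ ++ Δ) Λ from this [] hΓ
  clear hΓ
  induction h with
  | nil => exact fun _ => id
  | cons A _ ih => exact fun Ξ h => by simpa using ih (Ξ ++ [A]) (by simpa using h)
  | swap A B Γ => exact fun Ξ ⟨p, hp⟩ => ⟨p.exchL, hp⟩
  | trans _ _ ih₁ ih₂ => exact fun Ξ h => ih₂ Ξ (ih₁ Ξ h)

theorem append_left (h : Provable S n Γ Λ) (Δ : List (Formula L)) :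
    Provable S n (Δ ++ Γ) Λ := by
  induction Δ with
  | nil => exact h
  | cons A _ ih =>
    obtain ⟨p, hp⟩ := ih
    exact ⟨p.weakL A, hp⟩

theorem of_cons_of_mem (h : Provable S n (C :: Γ) Λ) (hC : C ∈ Γ) : Provable S n Γ Λ := by
  obtain ⟨Δ₁, Δ₂, rfl⟩ := List.append_of_mem hC
  obtain ⟨p, hp⟩ := h.perm (List.perm_middle.cons C)
  exact perm List.perm_middle.symm ⟨p.contrL, hp⟩

theorem of_append_of_subset (h : Provable S n (Γ ++ Δ) Λ) (hΓ : Γ ⊆ Δ) :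
    Provable S n Δ Λ := by
  induction Γ with
  | nil => exact h
  | cons A Γ ih =>
    obtain ⟨hA, hΓ⟩ := List.cons_subset.1 hΓ
    exact ih (h.of_cons_of_mem (List.mem_append_right Γ hA)) hΓ

theorem weaken (h : Provable S n Γ Λ) (hΓ : Γ ⊆ Δ) : Provable S n Δ Λ :=
  ((h.append_left Δ).perm List.perm_append_comm).of_append_of_subset hΓ

theorem ax (hn : 0 < n) (hC : C ∈ Γ) : Provable S n Γ (some C) :=
  weaken ⟨.ax C, hn⟩ (List.cons_subset.2 ⟨hC, List.nil_subset Γ⟩)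

theorem cut (hC : C.degree < n) (left : Provable S n Γ (some C))
    (right : Provable S n (C :: Γ) Λ) : Provable S n Γ Λ := by
  obtain ⟨p, hp⟩ := left
  obtain ⟨q, hq⟩ := right
  have h : Provable S n (Γ ++ Γ) Λ := ⟨.cut C p q, Proof.degree_cut_lt.2 ⟨hC, hp, hq⟩⟩
  exact h.weaken (by simp)

theorem left {M P : Set (Formula L)} (rule : LeftRule Λ C M P) (hC : C ∈ Γ)
    (minor : ∀ A ∈ M, Provable S n Γ (some A)) (major : ∀ A ∈ P, Provable S n (A :: Γ) Λ) :
    Provable S n Γ Λ := by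
  suffices Provable S n (C :: Γ) Λ from this.of_cons_of_mem hC
  cases rule with
  | neg A =>
    obtain ⟨p, hp⟩ := minor A rfl
    exact ⟨p.negL, hp⟩
  | and₁ _ A B =>
    obtain ⟨p, hp⟩ := major A rfl
    exact ⟨p.andL₁ B, hp⟩
  | and₂ _ A B =>
    obtain ⟨p, hp⟩ := major B rfl
    exact ⟨p.andL₂ A, hp⟩
  | or _ A B =>
    obtain ⟨p, hp⟩ := major A (.inl rfl)
    obtain ⟨q, hq⟩ := major B (.inr rfl)
    exact ⟨p.orL q, Proof.degree_orL_lt.2 ⟨hp, hq⟩⟩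
  | imp _ A B =>
    obtain ⟨p, hp⟩ := minor A rfl
    obtain ⟨q, hq⟩ := major B rfl
    have h : Provable S n (A.imp B :: (Γ ++ Γ)) Λ := ⟨p.impL q, Proof.degree_impL_lt.2 ⟨hp, hq⟩⟩
    exact h.weaken (by simp)
  | all _ A t =>
    obtain ⟨p, hp⟩ := major (A.inst t) rfl
    exact ⟨p.allL A t, hp⟩
  | ex _ A =>
    obtain ⟨a, ha⟩ := exists_fresh (A.ex :: Γ) Λ
    obtain ⟨p, hp⟩ := major (A.inst (Term.var a)) ⟨_, rfl⟩
    exact ⟨p.exL A a ha, hp⟩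

theorem right {P : Set (List (Formula L) × Option (Formula L))} (rule : RightRule C P)
    (premises : ∀ s ∈ P, Provable S n (s.1 ++ Γ) s.2) : Provable S n Γ (some C) := by
  cases rule with
  | neg A =>
    obtain ⟨p, hp⟩ := premises _ rfl
    exact ⟨p.negR, hp⟩
  | and A B =>
    obtain ⟨p, hp⟩ := premises _ (.inl rfl)
    obtain ⟨q, hq⟩ := premises _ (.inr rfl)
    exact ⟨p.andR q, Proof.degree_andR_lt.2 ⟨hp, hq⟩⟩
  | or₁ A B =>
    obtain ⟨p, hp⟩ := premises _ rfl
    exact ⟨p.orR₁ B, hp⟩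
  | or₂ A B =>
    obtain ⟨p, hp⟩ := premises _ rfl
    exact ⟨p.orR₂ A, hp⟩
  | imp A B =>
    obtain ⟨p, hp⟩ := premises _ rfl
    exact ⟨p.impR, hp⟩
  | all A =>
    obtain ⟨a, ha⟩ := exists_fresh Γ (some A.all)
    obtain ⟨p, hp⟩ := premises _ ⟨Term.var a, rfl⟩
    exact ⟨p.allR A a ha, hp⟩
  | ex A t =>
    obtain ⟨p, hp⟩ := premises _ rfl
    exact ⟨p.exR A t, hp⟩

theorem tnd (hS : S = System.MLplus) (pos : Provable S n (C :: Γ) Λ)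
    (neg : Provable S n (C.neg :: Γ) Λ) : Provable S n Γ Λ := by
  obtain ⟨p, hp⟩ := pos
  obtain ⟨q, hq⟩ := neg
  exact ⟨.tnd hS C p q, Proof.degree_tnd_lt.2 ⟨hp, hq⟩⟩

end Provable

theorem Derives.provable {L : Language} {S : System} {n : ℕ} {Γ : List (Formula L)}
    {Λ : Option (Formula L)} (hn : 0 < n) (h : Derives S n Γ Λ) : Provable S n Γ Λ := by
  induction h with
  | ax hA => exact .ax hn hA
  | cut A hA _ _ ihp ihq => exact .cut hA ihp ihq
  | left rule hC _ _ ih_minor ih_major => exact .left rule hC ih_minor ih_major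
  | right rule _ ih => exact .right rule ih
  | tnd hS A _ _ ihp ihq => exact .tnd hS ihp ihq

theorem Deletion.subset {L : Language} {C : Formula L} {Δ Δ' : List (Formula L)}
    (h : Deletion C Δ Δ') : Δ ⊆ C :: Δ' := by
  induction h with
  | nil => exact List.nil_subset _
  | keep A _ ih => exact append_subset_cons_append [A] ih
  | drop _ ih => exact List.cons_subset.2 ⟨List.mem_cons_self, ih⟩

end MinLogic

theorem lemma3_general {L : FirstOrder.Language} {S : MinLogic.System} {n : ℕ}
    {C : MinLogic.Formula L} (hC : C.degree ≤ n) {Γ Δ Θ : List (MinLogic.Formula L)}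
    {Λ : Option (MinLogic.Formula L)}
    (p : MinLogic.Proof S Γ (some C)) (hp : p.degree < n)
    (q : MinLogic.Proof S Δ Λ) (hq : q.degree < n) (hΓ : Γ ⊆ Θ) (hΔ : Δ ⊆ C :: Θ) :
    ∃ r : MinLogic.Proof S Θ Λ, r.degree < n :=
  (((p.derives hp).weaken hΓ).cut_of_degree_le hC ((q.derives hq).weaken hΔ)).provable
    (Nat.zero_lt_of_lt hp)

theorem lemma3 {L : FirstOrder.Language} (S : MinLogic.System) (n : ℕ) (C : MinLogic.Formula L)
    (hC : C.degree = n) (Γ Δ : List (MinLogic.Formula L)) (Λ : Option (MinLogic.Formula L))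
    (p : MinLogic.Proof S Γ (some C)) (hp : p.degree < n)
    (q : MinLogic.Proof S Δ Λ) (hq : q.degree < n)
    (Δ' : List (MinLogic.Formula L)) (hΔ' : MinLogic.Deletion C Δ Δ') :
    ∃ r : MinLogic.Proof S (Γ ++ Δ') Λ, r.degree < n := by
  exact lemma3_general hC.le p hp q hq (List.subset_append_left Γ Δ')
    (List.Subset.trans hΔ'.subset (List.cons_subset_cons C (List.subset_append_right Γ Δ')))
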